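/- Let $d \ge 0$, $x \in \mathbb{R}^d$, let $\Sigma$ be a symmetric positive semidefinite real $d \times d$ matrix, and let $\mu = \mathcal{N}(x, \Sigma)$ be the Gaussian measure on $\mathbb{R}^d$ with mean $x$ and covariance matrix $\Sigma$. For a non-negative $\mu$-integrable function $f : \mathbb{R}^d \to \mathbb{R}$ define the functional entropy $$\mathrm{Ent}_\mu(f) = \int_{\mathbb{R}^d} f(z) \log \frac{f(z)}{\int_{\mathbb{R}^d} f \, d\mu} \, d\mu(z) \in (-\infty, +\infty]$$ (with the convention that the integrand is $0$ where $f(z) = 0$), and, if $f$ is differentiable, the functional Fisher information $$\mathcal{I}_\mu(f) = \int_{\mathbb{R}^d} \frac{\langle \Sigma \nabla f(z), \nabla f(z) \rangle}{f(z)} \, d\mu(z) \in [0, +\infty]$$ (with the integrand equal to $0$ where $f(z) = 0$; there $\nabla f(z) = 0$ as well). Then every everywhere differentiable, $\mu$-integrable function $f : \mathbb{R}^d \to \mathbb{R}$ with $f \ge 0$ satisfies $$\mathrm{Ent}_\mu(f) \le \tfrac{1}{2}\, \mathcal{I}_\mu(f).$$ In particular, if $\mathcal{I}_\mu(f) < \infty$,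 then $\mathrm{Ent}_\mu(f)$ is finite. -/

import Mathlib

open MeasureTheory ProbabilityTheory
open scoped ENNReal

noncomputable section

/-- The integral of a real function `h` as an extended real number, `∫ h⁺ dμ - ∫ h⁻ dμ`.
For a measurable `h` it is the usual integral as soon as one of the two terms is finite, and for
an integrable `h` it is the Bochner integral (`extIntegral_eq_integral`). -/
def extIntegral {E : Type*} [MeasurableSpace E] (μ : Measure E) (h : E → ℝ) : EReal :=
  ((∫⁻ z, ENNReal.ofReal (h z) ∂μ : ℝ≥0∞) : EReal)
    - ((∫⁻ z, ENNReal.ofReal (-h z) ∂μ : ℝ≥0∞) : EReal)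

theorem extIntegral_eq_integral {E : Type*} [MeasurableSpace E] {μ : Measure E} {h : E → ℝ}
    (hh : Integrable h μ) : extIntegral μ h = ((∫ z, h z ∂μ : ℝ) : EReal) := by
  have h1 : ∫⁻ z, ENNReal.ofReal (h z) ∂μ ≠ ∞ := hh.lintegral_lt_top.ne
  have h2 : ∫⁻ z, ENNReal.ofReal (-h z) ∂μ ≠ ∞ := hh.neg.lintegral_lt_top.ne
  rw [extIntegral, integral_eq_lintegral_pos_part_sub_lintegral_neg_part hh, EReal.coe_sub,
    EReal.coe_ennreal_toReal h1, EReal.coe_ennreal_toReal h2]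

/-- The functional entropy `Ent_μ(f) = ∫ f log (f / ∫ f dμ) dμ` of an integrable function `f ≥ 0`,
with values in the extended reals and with the convention `0 log 0 = 0`. -/
def functionalEntropy {E : Type*} [MeasurableSpace E] (μ : Measure E) (f : E → ℝ) : EReal :=
  extIntegral μ (fun z => f z * Real.log (f z / ∫ w, f w ∂μ))

/-- The entropy integrand has a negative part with finite integral, so that the functional entropy
of a non-negative function is a well-defined element of `(-∞, +∞]`. -/
theorem functionalEntropy_negPart_lt_top {E : Type*} [MeasurableSpace E] (μ : Measure E)
    [IsProbabilityMeasure μ] (f : E → ℝ) (hf : ∀ z, 0 ≤ f z) :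
    ∫⁻ z, ENNReal.ofReal (-(f z * Real.log (f z / ∫ w, f w ∂μ))) ∂μ < ∞ := by
  have hm : 0 ≤ ∫ w, f w ∂μ := integral_nonneg hf
  generalize (∫ w, f w ∂μ) = m at hm ⊢
  refine lt_of_le_of_lt (lintegral_mono (g := fun _ => ENNReal.ofReal m) fun z => ?_) (by simp)
  refine ENNReal.ofReal_le_ofReal ?_
  rcases hm.eq_or_lt with rfl | hm
  · simp
  rcases (hf z).eq_or_lt with h | h
  · simp [← h, hm.le]
  · have h1 := Real.log_le_sub_one_of_pos (div_pos hm h)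
    rw [← inv_div, Real.log_inv] at h1
    have h2 := mul_le_mul_of_nonneg_left h1 h.le
    have h3 : f z * (m / f z - 1) = m - f z := by field_simp
    rw [inv_div, h3] at h2
    linarith

/-- The functional Fisher information `∫ ⟨S ∇f, ∇f⟩ / f dμ` of a function `f ≥ 0` on `ℝ^d` with
respect to the Gaussian measure `μ = N(x, S)`, with values in `[0, ∞]`. At a zero of a
differentiable `f ≥ 0` the gradient vanishes, and the integrand is `0` there. -/
def functionalFisherInfo {d : ℕ} (x : EuclideanSpace ℝ (Fin d)) (S : Matrix (Fin d) (Fin d) ℝ)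
    (f : EuclideanSpace ℝ (Fin d) → ℝ) : ℝ≥0∞ :=
  ∫⁻ z, ENNReal.ofReal
      (inner ℝ (Matrix.toEuclideanCLM (𝕜 := ℝ) S (gradient f z)) (gradient f z) / f z)
    ∂(multivariateGaussian x S)

end

/-! On the line, let `T` be the increasing map carrying the density `f φ` to `φ`, so that `T' = f φ
/ φ(T)`. Taking logarithms, using `log T' ≤ T' - 1` and completing a square bounds the entropy
density minus the Fisher density by the derivative of `(T - x) f φ` (`transport_entropy_le`).
Boundary terms vanish in the limit or have a favourable sign, giving `gaussianReal_logSobolev`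
without decay assumptions on `f`.

Entropy is carried by the nonnegative integrand `logDivergence (f z) (∫ f)`, so the inequalities
hold in `[0, ∞]`. Its joint convexity yields subadditivity over products
(`lintegral_logDivergence_prod_le`), and induction on the dimension gives the standard Gaussian
case. Zeros of `f` are reached through `f + ε` and Fatou's lemma. The affine map `y ↦ x + √S y` then
gives every `N(x, S)`, including singular `S`. -/

section GaussianLogSobolev

open Set Filter Topology

/-! ### Bregman divergence of the entropy -/

/-- The Bregman divergence `a log (a / b) - a + b` of `t ↦ t log t`. -/
noncomputable def logDivergence (a b : ℝ) : ℝ := a * Real.log (a / b) - a + b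

theorem logDivergence_nonneg {a b : ℝ} (ha : 0 < a) (hb : 0 < b) : 0 ≤ logDivergence a b := by
  have h1 := Real.log_le_sub_one_of_pos (div_pos hb ha)
  rw [← inv_div, Real.log_inv] at h1
  have h2 := mul_le_mul_of_nonneg_left h1 ha.le
  have h3 : a * (b / a - 1) = b - a := by field_simp
  rw [inv_div, h3] at h2
  unfold logDivergence
  linarith

theorem logDivergence_mul_left {c : ℝ} (hc : 0 < c) (a b : ℝ) :
    logDivergence (c * a) (c * b) = c * logDivergence a b := by
  unfold logDivergence
  rw [mul_div_mul_left _ _ hc.ne']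
  ring

/-! ### Distribution functions and monotone transport on the line -/

section Primitive

variable {h : ℝ → ℝ}

theorem hasStrictDerivAt_integral_Iic (hc : Continuous h) (hi : Integrable h) (x : ℝ) :
    HasStrictDerivAt (fun x => ∫ t in Iic x, h t) (h x) x := by
  have h1 : (fun x => ∫ t in Iic x, h t) = fun x => (∫ t in Iic 0, h t) + ∫ t in (0 : ℝ)..x, h t := by
    ext x
    rw [← intervalIntegral.integral_Iic_sub_Iic hi.integrableOn hi.integrableOn]
    ring
  rw [h1]
  exact (intervalIntegral.integral_hasStrictDerivAt_right hi.intervalIntegrable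
    (hc.stronglyMeasurableAtFilter _ _) hc.continuousAt).const_add _

theorem strictMono_integral_Iic (hc : Continuous h) (hi : Integrable h) (hpos : ∀ x, 0 < h x) :
    StrictMono fun x => ∫ t in Iic x, h t :=
  strictMono_of_hasDerivAt_pos (fun x => (hasStrictDerivAt_integral_Iic hc hi x).hasDerivAt) hpos

theorem tendsto_integral_Iic_atTop (hi : Integrable h) :
    Tendsto (fun x => ∫ t in Iic x, h t) atTop (𝓝 (∫ t, h t)) :=
  (aecover_Iic tendsto_id).integral_tendsto_of_countably_generated hi

theorem tendsto_integral_Iic_atBot (hi : Integrable h) :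
    Tendsto (fun x => ∫ t in Iic x, h t) atBot (𝓝 0) := by
  have h1 : Tendsto (fun x => ∫ t in Ioi x, h t) atBot (𝓝 (∫ t, h t)) :=
    (aecover_Ioi tendsto_id).integral_tendsto_of_countably_generated hi
  have h2 : (fun x => ∫ t in Iic x, h t) = fun x => (∫ t, h t) - ∫ t in Ioi x, h t := by
    ext x
    rw [← intervalIntegral.integral_Iic_add_Ioi (b := x) hi.integrableOn hi.integrableOn]
    ring
  rw [h2]
  simpa using h1.const_sub (∫ t, h t)

theorem range_integral_Iic (hc : Continuous h) (hi : Integrable h) (hpos : ∀ x, 0 < h x) :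
    range (fun x => ∫ t in Iic x, h t) = Ioo 0 (∫ t, h t) := by
  have hm := strictMono_integral_Iic hc hi hpos
  have hcont : Continuous fun x => ∫ t in Iic x, h t :=
    continuous_iff_continuousAt.2 fun x =>
      (hasStrictDerivAt_integral_Iic hc hi x).hasDerivAt.continuousAt
  ext y
  constructor
  · rintro ⟨x, rfl⟩
    constructor
    · exact (hm.monotone.le_of_tendsto (tendsto_integral_Iic_atBot hi) (x - 1)).trans_lt
        (hm (sub_one_lt x))
    · exact (hm (lt_add_one x)).trans_le
        (hm.monotone.ge_of_tendsto (tendsto_integral_Iic_atTop hi) (x + 1))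
  · rintro ⟨h0, h1⟩
    exact mem_range_of_exists_le_of_exists_ge hcont
      (((tendsto_integral_Iic_atBot hi).eventually_lt_const h0).exists.imp fun _ => le_of_lt)
      (((tendsto_integral_Iic_atTop hi).eventually_const_lt h1).exists.imp fun _ => le_of_lt)

/-- The increasing rearrangement between two positive continuous densities on the line. -/
theorem exists_monotone_transport {k : ℝ → ℝ} (hc : Continuous h) (hi : Integrable h)
    (hpos : ∀ x, 0 < h x) (kc : Continuous k) (ki : Integrable k) (kpos : ∀ x, 0 < k x)
    (heq : ∫ t, h t = ∫ t, k t) :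
    ∃ T : ℝ → ℝ, (∀ x, HasDerivAt T (h x / k (T x)) x) ∧ Tendsto T atTop atTop ∧
      Tendsto T atBot atBot := by
  set G : ℝ → ℝ := fun x => ∫ t in Iic x, h t with hG
  set K : ℝ → ℝ := fun x => ∫ t in Iic x, k t with hK
  -- Equal total masses make the ranges agree, so `K ∘ T = G` defines a bijection of the line.
  have hr : range G = range K := by
    rw [hG, hK, range_integral_Iic hc hi hpos, range_integral_Iic kc ki kpos, heq]
  have hGm : StrictMono G := strictMono_integral_Iic hc hi hpos
  have hKm : StrictMono K := strictMono_integral_Iic kc ki kpos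
  have hex : ∀ x, ∃ t, K t = G x := fun x => by
    have : G x ∈ range K := hr ▸ mem_range_self x
    exact this
  choose T hT using hex
  have hTm : StrictMono T := fun x y hxy => by
    rw [← hKm.lt_iff_lt, hT, hT]
    exact hGm hxy
  have hTs : Function.Surjective T := fun t => by
    have : K t ∈ range G := hr ▸ mem_range_self t
    obtain ⟨x, hx⟩ := this
    exact ⟨x, hKm.injective (by rw [hT, hx])⟩
  let e := hTm.orderIsoOfSurjective T hTs
  have he : ⇑e = T := rfl
  have hTc : Continuous T := he ▸ e.continuous
  refine ⟨T, fun x => ?_, he ▸ e.tendsto_atTop, he ▸ e.tendsto_atBot⟩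
  have hKd : HasStrictDerivAt K (k (T x)) (T x) := hasStrictDerivAt_integral_Iic kc ki _
  have hGd : HasDerivAt G (h x) x := (hasStrictDerivAt_integral_Iic hc hi x).hasDerivAt
  -- Near `x`, `T` is `G` followed by a local inverse of `K`; this is where strict differentiability
  -- is needed.
  have hinv := hKd.to_localInverse (kpos (T x)).ne'
  have hev := (hKd.hasStrictFDerivAt_equiv (kpos (T x)).ne').eventually_left_inverse
  rw [hT] at hinv
  have hcomp := hinv.hasDerivAt.comp x hGd
  rw [div_eq_inv_mul]
  refine hcomp.congr_of_eventuallyEq ?_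
  filter_upwards [hTc.continuousAt.eventually hev] with y hy
  rw [hT] at hy
  exact hy.symm

end Primitive

/-! ### The one-dimensional inequality -/

section Line

local notation "φ" => gaussianPDFReal 0 1

theorem gaussianPDFReal_zero_one_eq (x : ℝ) :
    φ x = (Real.sqrt (2 * Real.pi))⁻¹ * Real.exp (-x ^ 2 / 2) := by
  simp [gaussianPDFReal]

theorem gaussianPDFReal_zero_one_pos (x : ℝ) : 0 < φ x :=
  gaussianPDFReal_pos 0 1 x one_ne_zero

theorem hasDerivAt_gaussianPDFReal_zero_one (x : ℝ) : HasDerivAt φ (-x * φ x) x := by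
  have h1 : φ = fun x => (Real.sqrt (2 * Real.pi))⁻¹ * Real.exp (-x ^ 2 / 2) :=
    funext gaussianPDFReal_zero_one_eq
  have h2 : HasDerivAt (fun x : ℝ => -x ^ 2 / 2) (-x) x := by
    have := ((hasDerivAt_pow 2 x).fun_neg).div_const 2
    exact this.congr_deriv (by norm_num; ring)
  rw [gaussianPDFReal_zero_one_eq]
  rw [h1]
  exact (h2.exp.const_mul (Real.sqrt (2 * Real.pi))⁻¹).congr_deriv (by ring)

theorem continuous_gaussianPDFReal_zero_one : Continuous φ :=
  continuous_iff_continuousAt.2 fun x => (hasDerivAt_gaussianPDFReal_zero_one x).continuousAt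

theorem tendsto_gaussianPDFReal_zero_one_cocompact : Tendsto φ (cocompact ℝ) (𝓝 0) := by
  have h1 : φ = fun x => (Real.sqrt (2 * Real.pi))⁻¹ * Real.exp (-(1 / 2) * x ^ 2) := by
    ext x
    rw [gaussianPDFReal_zero_one_eq]
    ring_nf
  rw [h1]
  simpa using (tendsto_rpow_abs_mul_exp_neg_mul_sq_cocompact (a := 1 / 2) (by norm_num) 0).const_mul
    (Real.sqrt (2 * Real.pi))⁻¹

theorem log_gaussianPDFReal_zero_one (x : ℝ) :
    Real.log (φ x) = Real.log (Real.sqrt (2 * Real.pi))⁻¹ - x ^ 2 / 2 := by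
  rw [gaussianPDFReal_zero_one_eq, Real.log_mul (by positivity) (Real.exp_pos _).ne', Real.log_exp]
  ring

theorem lintegral_gaussianReal_zero_one {g : ℝ → ℝ} (hg : Measurable g) :
    ∫⁻ x, ENNReal.ofReal (g x) ∂(gaussianReal 0 1) = ∫⁻ x, ENNReal.ofReal (g x * φ x) := by
  rw [gaussianReal_of_var_ne_zero _ one_ne_zero,
    lintegral_withDensity_eq_lintegral_mul _ (measurable_gaussianPDF _ _) hg.ennreal_ofReal]
  refine lintegral_congr fun x => ?_
  rw [Pi.mul_apply, gaussianPDF, mul_comm, ENNReal.ofReal_mul' (gaussianPDFReal_nonneg _ _ _)]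

theorem integrable_gaussianReal_zero_one_iff {g : ℝ → ℝ} :
    Integrable g (gaussianReal 0 1) ↔ Integrable fun x => g x * φ x := by
  rw [gaussianReal_of_var_ne_zero _ one_ne_zero,
    integrable_withDensity_iff_integrable_smul' (measurable_gaussianPDF _ _)
      (ae_of_all _ fun _ => gaussianPDF_lt_top)]
  simp [toReal_gaussianPDF, mul_comm]

theorem integral_gaussianReal_zero_one (g : ℝ → ℝ) :
    ∫ x, g x ∂(gaussianReal 0 1) = ∫ x, g x * φ x := by
  rw [integral_gaussianReal_eq_integral_smul one_ne_zero]
  simp [mul_comm]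

/-- A differentiable function with a limit along `atTop` has small derivative arbitrarily far. -/
theorem exists_seq_deriv_tendsto_zero_atTop {u u' : ℝ → ℝ} {c : ℝ}
    (hu : ∀ x, HasDerivAt u (u' x) x) (hc : Tendsto u atTop (𝓝 c)) :
    ∃ b : ℕ → ℝ, (∀ n : ℕ, (n : ℝ) < b n) ∧ Tendsto (fun n => u' (b n)) atTop (𝓝 0) := by
  -- Mean value theorem on `[n, n + 1]`; the increments of `u` tend to zero.
  have hmv : ∀ n : ℕ, ∃ b, (n : ℝ) < b ∧ u' b = u (n + 1) - u n := fun n => by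
    obtain ⟨b, hb, hb'⟩ := exists_hasDerivAt_eq_slope u u' (lt_add_one (n : ℝ))
      (fun x _ => (hu x).continuousAt.continuousWithinAt) (fun x _ => hu x)
    exact ⟨b, hb.1, by simpa using hb'⟩
  choose b hb hb' using hmv
  refine ⟨b, hb, ?_⟩
  simp_rw [hb']
  have h1 : Tendsto (fun n : ℕ => u n) atTop (𝓝 c) := hc.comp tendsto_natCast_atTop_atTop
  have h2 : Tendsto (fun n : ℕ => u (n + 1)) atTop (𝓝 c) :=
    hc.comp (tendsto_atTop_add_const_right _ _ tendsto_natCast_atTop_atTop)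
  simpa using h2.sub h1

theorem exists_seq_deriv_tendsto_zero_atBot {u u' : ℝ → ℝ} {c : ℝ}
    (hu : ∀ x, HasDerivAt u (u' x) x) (hc : Tendsto u atBot (𝓝 c)) :
    ∃ a : ℕ → ℝ, (∀ n, a n < -(n : ℝ)) ∧ Tendsto (fun n => u' (a n)) atTop (𝓝 0) := by
  obtain ⟨b, hb, hb'⟩ := exists_seq_deriv_tendsto_zero_atTop (u := fun x => u (-x))
    (u' := fun x => -u' (-x)) (c := c)
    (fun x => by
      have h0 : HasDerivAt (fun y : ℝ => -y) (-1) x := hasDerivAt_neg x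
      simpa [Function.comp_def] using (hu (-x)).comp x h0)
    (hc.comp tendsto_neg_atTop_atBot)
  exact ⟨fun n => -b n, fun n => neg_lt_neg (hb n), by simpa using hb'.neg⟩

/-- Here `t` plays `T x` and `y φ x / φ t` plays `T'`. The bound `log T' ≤ T' - 1` leaves a term `-y
(t - x)² / 2`, absorbed by the square `(y (t - x) + y')² / (2 y) ≥ 0`. The summand `1 - y` on both
sides makes the entropy integrand nonnegative. -/
theorem transport_entropy_le {y y' x t : ℝ} (hy : 0 < y) :
    (y * Real.log y - y + 1) * φ x - (1 / 2 * (y' ^ 2 / y) + 1 - y) * φ x ≤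
      (y * φ x / φ t - 1) * (y * φ x) + (t - x) * (y' * φ x + y * (-x * φ x)) := by
  have hx := gaussianPDFReal_zero_one_pos x
  have ht := gaussianPDFReal_zero_one_pos t
  have hlog := Real.log_le_sub_one_of_pos (div_pos (mul_pos hy hx) ht)
  rw [Real.log_div (mul_pos hy hx).ne' ht.ne', Real.log_mul hy.ne' hx.ne',
    log_gaussianPDFReal_zero_one, log_gaussianPDFReal_zero_one] at hlog
  generalize y * φ x / φ t = T' at hlog ⊢
  have h1 := mul_le_mul_of_nonneg_left hlog hy.le
  have h2 : 0 ≤ (y * (t - x) + y') ^ 2 / (2 * y) := by positivity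
  have h3 : (y * (t - x) + y') ^ 2 / (2 * y) =
      y * (t - x) ^ 2 / 2 + (t - x) * y' + 1 / 2 * (y' ^ 2 / y) := by field_simp; ring
  rw [h3] at h2
  have h4 : 0 ≤ ((T' - 1) * y + (t - x) * (y' - x * y) - y * Real.log y
      + 1 / 2 * (y' ^ 2 / y)) * φ x := by
    refine mul_nonneg ?_ hx.le
    nlinarith
  nlinarith

theorem gaussianReal_logSobolev_of_integral_eq_one {f : ℝ → ℝ} (hf : ∀ x, 0 < f x)
    (hdiff : Differentiable ℝ f) (hint : Integrable f (gaussianReal 0 1))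
    (hone : ∫ x, f x ∂(gaussianReal 0 1) = 1) :
    ∫⁻ x, ENNReal.ofReal (logDivergence (f x) 1) ∂(gaussianReal 0 1) ≤
      ∫⁻ x, ENNReal.ofReal (1 / 2 * (deriv f x ^ 2 / f x)) ∂(gaussianReal 0 1) := by
  have hφ := gaussianPDFReal_zero_one_pos
  have hφc := continuous_gaussianPDFReal_zero_one
  have hfm : Measurable f := hdiff.continuous.measurable
  have hψ : Continuous fun x => f x * Real.log (f x) - f x + 1 :=
    ((hdiff.continuous.mul (hdiff.continuous.log fun x => (hf x).ne')).sub
      hdiff.continuous).add continuous_const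
  have hψ0 : ∀ x, 0 ≤ f x * Real.log (f x) - f x + 1 := fun x => by
    simpa [logDivergence] using logDivergence_nonneg (hf x) one_pos
  have hJm : Measurable fun x => 1 / 2 * (deriv f x ^ 2 / f x) := by fun_prop
  have hJ0 : ∀ x, 0 ≤ 1 / 2 * (deriv f x ^ 2 / f x) := fun x => by
    have := hf x
    positivity
  simp only [logDivergence, div_one]
  rw [lintegral_gaussianReal_zero_one hψ.measurable, lintegral_gaussianReal_zero_one hJm]
  by_cases hfin : ∫⁻ x, ENNReal.ofReal (1 / 2 * (deriv f x ^ 2 / f x) * φ x) = ∞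
  · rw [hfin]
    exact le_top
  have hJi : Integrable fun x => 1 / 2 * (deriv f x ^ 2 / f x) * φ x :=
    ⟨(hJm.mul (measurable_gaussianPDFReal 0 1)).aestronglyMeasurable, by
      rw [hasFiniteIntegral_iff_ofReal (ae_of_all _ fun x => mul_nonneg (hJ0 x) (hφ x).le)]
      exact lt_top_iff_ne_top.2 hfin⟩
  have hfi : Integrable fun x => f x * φ x := integrable_gaussianReal_zero_one_iff.1 hint
  have hφi : Integrable φ := integrable_gaussianPDFReal 0 1
  have hf1 : ∫ x, f x * φ x = 1 := by rw [← integral_gaussianReal_zero_one, hone]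
  have hφ1 : ∫ x, φ x = 1 := integral_gaussianPDFReal_eq_one 0 one_ne_zero
  obtain ⟨T, hT, hTtop, hTbot⟩ := exists_monotone_transport (hdiff.continuous.mul hφc) hfi
    (fun x => mul_pos (hf x) (hφ x)) hφc hφi hφ (hf1.trans hφ1.symm)
  -- The boundary term `T f φ` is `-(φ ∘ T)'`, and `φ ∘ T` vanishes at both ends, so this term tends
  -- to zero along suitable endpoints.
  have hderT : ∀ x, HasDerivAt (fun x => φ (T x)) (-(T x * (f x * φ x))) x := fun x => by
    have h1 := (hasDerivAt_gaussianPDFReal_zero_one (T x)).comp x (hT x)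
    refine h1.congr_deriv ?_
    have := (hφ (T x)).ne'
    rw [Pi.mul_apply]
    field_simp
  obtain ⟨b, hb, hb0⟩ := exists_seq_deriv_tendsto_zero_atTop hderT
    (tendsto_gaussianPDFReal_zero_one_cocompact.comp (hTtop.mono_right atTop_le_cocompact))
  obtain ⟨a, ha, ha0⟩ := exists_seq_deriv_tendsto_zero_atBot hderT
    (tendsto_gaussianPDFReal_zero_one_cocompact.comp (hTbot.mono_right atBot_le_cocompact))
  have hW : ∀ x, HasDerivAt (fun x => (T x - x) * (f x * φ x))
      ((f x * φ x / φ (T x) - 1) * (f x * φ x) +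
        (T x - x) * (deriv f x * φ x + f x * (-x * φ x))) x := fun x =>
    ((hT x).sub (hasDerivAt_id x)).mul
      ((hdiff x).hasDerivAt.mul (hasDerivAt_gaussianPDFReal_zero_one x))
  have hui : Integrable fun x => (1 / 2 * (deriv f x ^ 2 / f x) + 1 - f x) * φ x := by
    have : Integrable fun x => (1 / 2 * (deriv f x ^ 2 / f x) * φ x + φ x) - f x * φ x :=
      (hJi.add hφi).sub hfi
    exact this.congr (ae_of_all _ fun x => by ring)
  -- The correction `1 - f` has Gaussian mean zero by normalization.
  have huI : ∫ x, (1 / 2 * (deriv f x ^ 2 / f x) + 1 - f x) * φ x =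
      ∫ x, 1 / 2 * (deriv f x ^ 2 / f x) * φ x := by
    have h1 : (fun x => (1 / 2 * (deriv f x ^ 2 / f x) + 1 - f x) * φ x) = fun x =>
        (1 / 2 * (deriv f x ^ 2 / f x) * φ x + φ x) - f x * φ x := by
      ext x
      ring
    rw [h1, integral_sub (hJi.fun_add hφi) hfi, integral_add hJi hφi, hf1, hφ1]
    ring
  have hψφ : Continuous fun x => (f x * Real.log (f x) - f x + 1) * φ x := hψ.mul hφc
  have hab : ∀ n, a n ≤ b n := fun n =>
    (ha n).le.trans ((neg_nonpos.2 n.cast_nonneg).trans (n.cast_nonneg.trans (hb n).le))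
  have hatend : Tendsto a atTop atBot :=
    tendsto_atBot_mono (fun n => (ha n).le)
      (tendsto_neg_atTop_atBot.comp tendsto_natCast_atTop_atTop)
  have hbtend : Tendsto b atTop atTop :=
    tendsto_atTop_mono (fun n => (hb n).le) tendsto_natCast_atTop_atTop
  have hcov : AECover (volume : Measure ℝ) atTop fun n => Ioc (a n) (b n) :=
    aecover_Ioc hatend hbtend
  have hkey : ∀ n, ∫ x in Ioc (a n) (b n), (f x * Real.log (f x) - f x + 1) * φ x ≤
      (-(T (a n) * (f (a n) * φ (a n))) - -(T (b n) * (f (b n) * φ (b n)))) +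
      ∫ x in Ioc (a n) (b n), (1 / 2 * (deriv f x ^ 2 / f x) + 1 - f x) * φ x := fun n => by
    have h1 := intervalIntegral.integral_le_sub_of_hasDeriv_right_of_le (hab n)
      (fun x _ => (hW x).continuousAt.continuousWithinAt) (fun x _ => (hW x).hasDerivWithinAt)
      ((hψφ.integrableOn_Icc).sub hui.integrableOn)
      (fun x _ => transport_entropy_le (x := x) (t := T x) (y' := deriv f x) (hf x))
    have h2 := intervalIntegral.integral_sub (hψφ.intervalIntegrable (μ := volume) (a n) (b n))
      (hui.intervalIntegrable (a := a n) (b := b n))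
    simp only [Pi.sub_apply] at h1
    rw [h2, intervalIntegral.integral_of_le (hab n), intervalIntegral.integral_of_le (hab n)] at h1
    -- With `a n ≤ 0 ≤ b n`, the `-x f φ` part of the boundary term has the right sign and is
    -- dropped.
    have h3 : 0 ≤ b n * (f (b n) * φ (b n)) :=
      mul_nonneg (n.cast_nonneg.trans (hb n).le) (mul_pos (hf _) (hφ _)).le
    have h4 : a n * (f (a n) * φ (a n)) ≤ 0 :=
      mul_nonpos_of_nonpos_of_nonneg ((ha n).le.trans (neg_nonpos.2 n.cast_nonneg))
        (mul_pos (hf _) (hφ _)).le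
    linarith
  have hlim : Tendsto (fun n => (-(T (a n) * (f (a n) * φ (a n))) -
      -(T (b n) * (f (b n) * φ (b n)))) +
      ∫ x in Ioc (a n) (b n), (1 / 2 * (deriv f x ^ 2 / f x) + 1 - f x) * φ x) atTop
      (𝓝 (∫ x, 1 / 2 * (deriv f x ^ 2 / f x) * φ x)) := by
    have := (ha0.sub hb0).add (hcov.integral_tendsto_of_countably_generated hui)
    rw [huI] at this
    simpa using this
  rw [← ofReal_integral_eq_lintegral_ofReal hJi
    (ae_of_all _ fun x => mul_nonneg (hJ0 x) (hφ x).le)]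
  refine le_of_tendsto_of_tendsto'
    (hcov.lintegral_tendsto_of_nat (hψφ.measurable.ennreal_ofReal).aemeasurable)
    (ENNReal.tendsto_ofReal hlim) fun n => ?_
  rw [← ofReal_integral_eq_lintegral_ofReal
    ((hψφ.integrableOn_Icc (a := a n) (b := b n)).mono_set Ioc_subset_Icc_self)
    (ae_of_all _ fun x => mul_nonneg (hψ0 x) (hφ x).le)]
  exact ENNReal.ofReal_le_ofReal (hkey n)

/-- The logarithmic Sobolev inequality for the standard Gaussian measure on the line. -/
theorem gaussianReal_logSobolev {f : ℝ → ℝ} (hf : ∀ x, 0 < f x)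
    (hdiff : Differentiable ℝ f) (hint : Integrable f (gaussianReal 0 1)) :
    ∫⁻ x, ENNReal.ofReal (logDivergence (f x) (∫ w, f w ∂(gaussianReal 0 1)))
        ∂(gaussianReal 0 1) ≤
      ∫⁻ x, ENNReal.ofReal (1 / 2 * (deriv f x ^ 2 / f x)) ∂(gaussianReal 0 1) := by
  set m := ∫ w, f w ∂(gaussianReal 0 1) with hm
  have hm0 : 0 < m := by
    rw [hm, integral_pos_iff_support_of_nonneg (fun x => (hf x).le) hint,
      Function.support_eq_univ fun x => (hf x).ne']
    simp
  -- Both sides are homogeneous of degree one in `f`, so the mean may be normalized.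
  have h1 := gaussianReal_logSobolev_of_integral_eq_one (f := fun x => m⁻¹ * f x)
    (fun x => mul_pos (inv_pos.2 hm0) (hf x)) (hdiff.const_mul _) (hint.const_mul _)
    (by rw [integral_const_mul, ← hm, inv_mul_cancel₀ hm0.ne'])
  have h2 : ∀ x, ENNReal.ofReal (logDivergence (f x) m) =
      ENNReal.ofReal m * ENNReal.ofReal (logDivergence (m⁻¹ * f x) 1) := fun x => by
    rw [← ENNReal.ofReal_mul hm0.le, ← logDivergence_mul_left hm0, mul_one,
      mul_inv_cancel_left₀ hm0.ne']
  have h3 : ∀ x, ENNReal.ofReal (1 / 2 * (deriv f x ^ 2 / f x)) = ENNReal.ofReal m *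
      ENNReal.ofReal (1 / 2 * (deriv (fun x => m⁻¹ * f x) x ^ 2 / (m⁻¹ * f x))) := fun x => by
    rw [← ENNReal.ofReal_mul hm0.le, deriv_const_mul _ (hdiff x)]
    congr 1
    have := (hf x).ne'
    field_simp
  simp_rw [h2, h3]
  rw [lintegral_const_mul' _ _ ENNReal.ofReal_ne_top, lintegral_const_mul' _ _ ENNReal.ofReal_ne_top]
  gcongr

end Line

/-! ### Subadditivity of entropy over products -/

section Tensorization

theorem measurable_logDivergence {E : Type*} [MeasurableSpace E] {g k : E → ℝ}
    (hg : Measurable g) (hk : Measurable k) : Measurable fun x => logDivergence (g x) (k x) := by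
  unfold logDivergence
  fun_prop

theorem integrable_of_lintegral_ofReal_ne_top {E : Type*} [MeasurableSpace E] {μ : Measure E}
    {g : E → ℝ} (hg : AEStronglyMeasurable g μ) (h0 : ∀ᵐ x ∂μ, 0 ≤ g x)
    (hfin : ∫⁻ x, ENNReal.ofReal (g x) ∂μ ≠ ∞) : Integrable g μ :=
  ⟨hg, by
    rw [hasFiniteIntegral_iff_ofReal h0]
    exact lt_top_iff_ne_top.2 hfin⟩

theorem integral_pos_of_forall_pos {E : Type*} [MeasurableSpace E] {μ : Measure E}
    [IsProbabilityMeasure μ] {g : E → ℝ} (hg : ∀ x, 0 < g x) (hi : Integrable g μ) :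
    0 < ∫ x, g x ∂μ := by
  rw [integral_pos_iff_support_of_nonneg (fun x => (hg x).le) hi,
    Function.support_eq_univ fun x => (hg x).ne']
  simp

variable {E F : Type*} [MeasurableSpace E] [MeasurableSpace F] {μ : Measure E} {ν : Measure F}
  [IsProbabilityMeasure μ] [IsProbabilityMeasure ν]

/-- Changing the reference value from the mean to `c` changes the divergence by an affine function
of `g`, whose integral is the last term. -/
theorem lintegral_logDivergence_le_add {g : E → ℝ} (hgm : Measurable g) (hg : ∀ x, 0 < g x)
    (hi : Integrable g μ) {c : ℝ} (hc : 0 < c) :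
    ∫⁻ x, ENNReal.ofReal (logDivergence (g x) c) ∂μ ≤
      ∫⁻ x, ENNReal.ofReal (logDivergence (g x) (∫ w, g w ∂μ)) ∂μ +
        ENNReal.ofReal (logDivergence (∫ w, g w ∂μ) c) := by
  have hA : 0 < ∫ w, g w ∂μ := integral_pos_of_forall_pos hg hi
  set A := ∫ w, g w ∂μ with hAdef
  by_cases hfin : ∫⁻ x, ENNReal.ofReal (logDivergence (g x) A) ∂μ = ∞
  · rw [hfin, top_add]
    exact le_top
  have h0 : ∀ x, 0 ≤ logDivergence (g x) A := fun x => logDivergence_nonneg (hg x) hA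
  have h1 : Integrable (fun x => logDivergence (g x) A) μ :=
    integrable_of_lintegral_ofReal_ne_top
      (measurable_logDivergence hgm measurable_const).aestronglyMeasurable (ae_of_all _ h0) hfin
  have h2 : Integrable (fun x => g x * Real.log (A / c) + (c - A)) μ :=
    (hi.mul_const _).add (integrable_const _)
  have h3 : ∀ x, logDivergence (g x) c =
      logDivergence (g x) A + (g x * Real.log (A / c) + (c - A)) := fun x => by
    unfold logDivergence
    rw [Real.log_div (hg x).ne' hc.ne', Real.log_div (hg x).ne' hA.ne',
      Real.log_div hA.ne' hc.ne']
    ring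
  have h4 : ∫ x, logDivergence (g x) c ∂μ =
      ∫ x, logDivergence (g x) A ∂μ + logDivergence A c := by
    simp_rw [h3]
    rw [integral_add h1 h2, integral_add (hi.mul_const _) (integrable_const _),
      integral_mul_const, ← hAdef, integral_const, probReal_univ, one_smul, logDivergence]
    ring
  rw [← ofReal_integral_eq_lintegral_ofReal h1 (ae_of_all _ h0),
    ← ENNReal.ofReal_add (integral_nonneg h0) (logDivergence_nonneg hA hc), ← h4,
    ofReal_integral_eq_lintegral_ofReal _
      (ae_of_all _ fun x => logDivergence_nonneg (hg x) hc)]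
  simp_rw [h3]
  exact h1.add h2

/-- Jensen's inequality for the jointly convex function `logDivergence`. -/
theorem logDivergence_integral_le {g k : E → ℝ} (hgm : Measurable g) (hkm : Measurable k)
    (hg : ∀ x, 0 < g x) (hk : ∀ᵐ x ∂μ, 0 < k x) (hgi : Integrable g μ) (hki : Integrable k μ)
    (hB : 0 < ∫ x, k x ∂μ) :
    ENNReal.ofReal (logDivergence (∫ x, g x ∂μ) (∫ x, k x ∂μ)) ≤
      ∫⁻ x, ENNReal.ofReal (logDivergence (g x) (k x)) ∂μ := by
  have hA : 0 < ∫ w, g w ∂μ := integral_pos_of_forall_pos hg hgi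
  set A := ∫ w, g w ∂μ with hAdef
  set B := ∫ w, k w ∂μ with hBdef
  by_cases hfin : ∫⁻ x, ENNReal.ofReal (logDivergence (g x) (k x)) ∂μ = ∞
  · rw [hfin]
    exact le_top
  have h0 : ∀ᵐ x ∂μ, 0 ≤ logDivergence (g x) (k x) := by
    filter_upwards [hk] with x hx using logDivergence_nonneg (hg x) hx
  have h1 : Integrable (fun x => logDivergence (g x) (k x)) μ :=
    integrable_of_lintegral_ofReal_ne_top
      (measurable_logDivergence hgm hkm).aestronglyMeasurable h0 hfin
  rw [← ofReal_integral_eq_lintegral_ofReal h1 h0]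
  refine ENNReal.ofReal_le_ofReal ?_
  have h2 : logDivergence A B = ∫ x, (g x * Real.log (A / B) + k x * (1 - A / B)) ∂μ := by
    rw [integral_add (hgi.mul_const _) (hki.mul_const _), integral_mul_const, integral_mul_const,
      ← hAdef, ← hBdef, logDivergence]
    field_simp
    ring
  rw [h2]
  refine integral_mono_ae ((hgi.mul_const _).add (hki.mul_const _)) h1 ?_
  filter_upwards [hk] with x hx
  -- Nonnegativity at `(g, k A / B)` is the tangent-plane inequality for `logDivergence` at `(A,
  -- B)`.
  have h3 := logDivergence_nonneg (hg x) (mul_pos hx (div_pos hA hB))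
  unfold logDivergence at h3 ⊢
  rw [Real.log_div (hg x).ne' (mul_pos hx (div_pos hA hB)).ne',
    Real.log_mul hx.ne' (div_pos hA hB).ne'] at h3
  rw [Real.log_div (hg x).ne' hx.ne']
  linarith

/-- Subadditivity of the entropy over product measures. -/
theorem lintegral_logDivergence_prod_le {f : E × F → ℝ} (hfm : Measurable f) (hf : ∀ z, 0 < f z)
    (hi : Integrable f (μ.prod ν)) :
    ∫⁻ z, ENNReal.ofReal (logDivergence (f z) (∫ w, f w ∂(μ.prod ν))) ∂(μ.prod ν) ≤
      ∫⁻ y, ∫⁻ x, ENNReal.ofReal (logDivergence (f (x, y)) (∫ w, f (w, y) ∂μ)) ∂μ ∂ν +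
        ∫⁻ x, ∫⁻ y, ENNReal.ofReal (logDivergence (f (x, y)) (∫ w, f (x, w) ∂ν)) ∂ν ∂μ := by
  have hm : 0 < ∫ w, f w ∂(μ.prod ν) := integral_pos_of_forall_pos hf hi
  set m := ∫ w, f w ∂(μ.prod ν)
  have hsx : Measurable fun y => ∫ w, f (w, y) ∂μ :=
    hfm.stronglyMeasurable.integral_prod_left'.measurable
  have hsy : Measurable fun x => ∫ w, f (x, w) ∂ν :=
    hfm.stronglyMeasurable.integral_prod_right'.measurable
  have hm1 : Measurable fun p : E × F => ENNReal.ofReal (logDivergence (f p) (∫ w, f (w, p.2) ∂μ)) :=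
    (measurable_logDivergence hfm (hsx.comp measurable_snd)).ennreal_ofReal
  have hm2 : Measurable fun p : E × F => ENNReal.ofReal (logDivergence (f p) (∫ w, f (p.1, w) ∂ν)) :=
    (measurable_logDivergence hfm (hsy.comp measurable_fst)).ennreal_ofReal
  rw [lintegral_lintegral_swap (μ := μ) (ν := ν)
      (f := fun x y => ENNReal.ofReal (logDivergence (f (x, y)) (∫ w, f (x, w) ∂ν)))
      hm2.aemeasurable,
    lintegral_prod_symm _ (measurable_logDivergence hfm measurable_const).ennreal_ofReal.aemeasurable,
    ← lintegral_add_left hm1.lintegral_prod_left']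
  refine lintegral_mono_ae ?_
  filter_upwards [hi.prod_left_ae] with y hy
  refine (lintegral_logDivergence_le_add (hfm.comp measurable_prodMk_right) (fun x => hf (x, y)) hy
    hm).trans (add_le_add le_rfl ?_)
  -- Writing `m` as the `μ`-mean of `x ↦ ∫ f (x, w) dν` lets Jensen in `x` bound the divergence of
  -- the slice mean at `y` from `m`.
  have hG : ∫ x, ∫ w, f (x, w) ∂ν ∂μ = m := (integral_prod f hi).symm
  rw [← hG]
  refine logDivergence_integral_le (hfm.comp measurable_prodMk_right) hsy (fun x => hf (x, y)) ?_ hy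
    hi.integral_prod_left (hG.symm ▸ hm)
  filter_upwards [hi.prod_right_ae] with x hx using integral_pos_of_forall_pos (fun w => hf (x, w)) hx

end Tensorization

/-! ### Induction on the dimension for the standard Gaussian -/

theorem measurePreserving_finCons {n : ℕ} (μ : Measure ℝ) [SigmaFinite μ] :
    MeasurePreserving (fun p : ℝ × (Fin n → ℝ) => (Fin.cons p.1 p.2 : Fin (n + 1) → ℝ))
      (μ.prod (Measure.pi fun _ => μ)) (Measure.pi fun _ => μ) := by
  have h := (measurePreserving_piFinSuccAbove (fun _ : Fin (n + 1) => μ) 0).symm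
  convert h using 1
  ext p i
  simp [MeasurableEquiv.piFinSuccAbove, Fin.insertNthEquiv]

theorem cons_add_smul_single_succ {n : ℕ} (a t : ℝ) (y : Fin n → ℝ) (i : Fin n) :
    (Fin.cons a y : Fin (n + 1) → ℝ) + t • Pi.single i.succ 1 =
      Fin.cons a (y + t • (Pi.single i 1 : Fin n → ℝ)) := by
  ext j
  refine Fin.cases ?_ (fun k => ?_) j
  · simp
  · simp [Pi.single_apply]

theorem cons_add_smul_single_zero {n : ℕ} (a t : ℝ) (y : Fin n → ℝ) :
    (Fin.cons a y : Fin (n + 1) → ℝ) + t • Pi.single 0 1 = Fin.cons (a + t) y := by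
  ext j
  refine Fin.cases ?_ (fun k => ?_) j
  · simp
  · simp

/-- The logarithmic Sobolev inequality for the standard Gaussian measure on `ℝ^n`. -/
theorem pi_gaussianReal_logSobolev {n : ℕ} {f : (Fin n → ℝ) → ℝ} (hf : ∀ z, 0 < f z)
    (hdiff : Differentiable ℝ f) (hint : Integrable f (Measure.pi fun _ => gaussianReal 0 1)) :
    ∫⁻ z, ENNReal.ofReal (logDivergence (f z) (∫ w, f w ∂(Measure.pi fun _ => gaussianReal 0 1)))
        ∂(Measure.pi fun _ => gaussianReal 0 1) ≤
      ∑ i, ∫⁻ z, ENNReal.ofReal (1 / 2 * (lineDeriv ℝ f z (Pi.single i 1) ^ 2 / f z))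
        ∂(Measure.pi fun _ => gaussianReal 0 1) := by
  induction n with
  | zero =>
    have h1 : f = fun _ => f 0 := funext fun z => congrArg f (Subsingleton.elim z 0)
    rw [h1]
    simp [logDivergence]
  | succ n ih =>
    have mp := measurePreserving_finCons (n := n) (gaussianReal 0 1)
    set P : Measure (Fin n → ℝ) := Measure.pi fun _ => gaussianReal 0 1
    have hg : Differentiable ℝ fun p : ℝ × (Fin n → ℝ) => f (Fin.cons p.1 p.2) :=
      hdiff.comp (differentiable_finCons.2 ⟨differentiable_fst, differentiable_snd⟩)
    have hgi : Integrable (fun p : ℝ × (Fin n → ℝ) => f (Fin.cons p.1 p.2))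
        ((gaussianReal 0 1).prod P) := mp.integrable_comp_of_integrable hint
    have hm : ∀ i : Fin (n + 1), Measurable fun z =>
        ENNReal.ofReal (1 / 2 * (lineDeriv ℝ f z (Pi.single i 1) ^ 2 / f z)) := fun i =>
      (((measurable_lineDeriv hdiff.continuous).pow_const 2).div
        hdiff.continuous.measurable).const_mul (1 / 2) |>.ennreal_ofReal
    have hm' : ∀ i : Fin (n + 1), Measurable fun p : ℝ × (Fin n → ℝ) => ENNReal.ofReal
        (1 / 2 * (lineDeriv ℝ f (Fin.cons p.1 p.2) (Pi.single i 1) ^ 2 /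
          f (Fin.cons p.1 p.2))) := fun i => (hm i).comp mp.measurable
    have hmean : ∫ w, f w ∂(Measure.pi fun _ : Fin (n + 1) => gaussianReal 0 1) =
        ∫ p, f (Fin.cons p.1 p.2) ∂((gaussianReal 0 1).prod P) := by
      rw [← mp.map_eq, integral_map mp.aemeasurable
        hdiff.continuous.measurable.aestronglyMeasurable]
    rw [hmean, ← mp.lintegral_comp (measurable_logDivergence hdiff.continuous.measurable
      measurable_const).ennreal_ofReal, Fin.sum_univ_succ]
    refine (lintegral_logDivergence_prod_le hg.continuous.measurable (fun p => hf _) hgi).trans ?_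
    refine add_le_add ?_ ?_
    · rw [← mp.lintegral_comp (hm 0),
        lintegral_prod_symm _ (hm' 0).aemeasurable]
      refine lintegral_mono_ae ?_
      filter_upwards [hgi.prod_left_ae] with y hy
      refine (gaussianReal_logSobolev (fun x => hf _)
        (hg.comp (differentiable_id.prodMk (differentiable_const y))) hy).trans_eq ?_
      refine lintegral_congr fun a => ?_
      have h1 : lineDeriv ℝ f (Fin.cons a y) (Pi.single 0 1) =
          deriv (fun x => f (Fin.cons x y)) a := by
        simp only [lineDeriv, cons_add_smul_single_zero]
        rw [deriv_comp_const_add (fun x => f (Fin.cons x y)), add_zero]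
      simp only [h1]
      rfl
    · simp_rw [← mp.lintegral_comp (hm (Fin.succ _))]
      have h2 : ∀ i : Fin n, ∫⁻ p : ℝ × (Fin n → ℝ), ENNReal.ofReal
          (1 / 2 * (lineDeriv ℝ f (Fin.cons p.1 p.2) (Pi.single i.succ 1) ^ 2 /
            f (Fin.cons p.1 p.2))) ∂((gaussianReal 0 1).prod P) =
          ∫⁻ a, ∫⁻ y, ENNReal.ofReal
          (1 / 2 * (lineDeriv ℝ f (Fin.cons a y) (Pi.single i.succ 1) ^ 2 /
            f (Fin.cons a y))) ∂P ∂(gaussianReal 0 1) := fun i =>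
        lintegral_prod _ (hm' i.succ).aemeasurable
      simp_rw [h2]
      rw [← lintegral_finsetSum _ fun i _ =>
        (hm' (Fin.succ i)).lintegral_prod_right']
      refine lintegral_mono_ae ?_
      filter_upwards [hgi.prod_right_ae] with a ha
      refine (ih (fun y => hf _)
        (hg.comp ((differentiable_const a).prodMk differentiable_id)) ha).trans_eq ?_
      refine Finset.sum_congr rfl fun i _ => lintegral_congr fun y => ?_
      have h1 : lineDeriv ℝ f (Fin.cons a y) (Pi.single i.succ 1) =
          lineDeriv ℝ (fun y => f (Fin.cons a y)) y (Pi.single i 1) := by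
        simp only [lineDeriv, cons_add_smul_single_succ]
      simp only [h1]
      rfl

/-! ### From positive to nonnegative functions -/

theorem logDivergence_eq_of_pos {b : ℝ} (a : ℝ) (hb : 0 < b) :
    logDivergence a b = a * Real.log a - a * Real.log b - a + b := by
  rcases eq_or_ne a 0 with rfl | ha
  · simp [logDivergence]
  · rw [logDivergence, Real.log_div ha hb.ne']
    ring

theorem logDivergence_nonneg' {a b : ℝ} (ha : 0 ≤ a) (hb : 0 < b) : 0 ≤ logDivergence a b := by
  rcases ha.eq_or_lt with rfl | ha
  · simpa [logDivergence] using hb.le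
  · exact logDivergence_nonneg ha hb

theorem tendsto_logDivergence_add {a b : ℝ} (hb : 0 < b) {ε : ℕ → ℝ} (hε : ∀ n, 0 < ε n)
    (hlim : Tendsto ε atTop (𝓝 0)) :
    Tendsto (fun n => logDivergence (a + ε n) (b + ε n)) atTop (𝓝 (logDivergence a b)) := by
  simp_rw [fun n => logDivergence_eq_of_pos (a + ε n) (add_pos hb (hε n)),
    logDivergence_eq_of_pos a hb]
  have h1 : Tendsto (fun n => a + ε n) atTop (𝓝 a) := by simpa using hlim.const_add a
  have h2 : Tendsto (fun n => b + ε n) atTop (𝓝 b) := by simpa using hlim.const_add b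
  exact (((Real.continuous_mul_log.continuousAt.tendsto.comp h1).sub
    (h1.mul (h2.log hb.ne'))).sub h1).add h2

/-- A zero of `f` is a minimum along every line through it. -/
theorem lineDeriv_eq_zero_of_nonneg {E : Type*} [AddCommGroup E] [Module ℝ E] {f : E → ℝ}
    (hf : ∀ z, 0 ≤ f z) {z : E} (hz : f z = 0) (v : E) : lineDeriv ℝ f z v = 0 := by
  refine IsLocalMin.deriv_eq_zero (Filter.Eventually.of_forall fun t => ?_)
  simpa [hz] using hf (z + t • v)

/-- Adding `ε` keeps derivatives and raises the denominator, so the Fisher terms of `f + ε` are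
bounded by those of `f`; Fatou handles the entropy as `ε → 0`. -/
theorem pi_gaussianReal_logSobolev_of_nonneg {n : ℕ} {f : (Fin n → ℝ) → ℝ} (hf : ∀ z, 0 ≤ f z)
    (hdiff : Differentiable ℝ f) (hint : Integrable f (Measure.pi fun _ => gaussianReal 0 1))
    (hm : 0 < ∫ w, f w ∂(Measure.pi fun _ => gaussianReal 0 1)) :
    ∫⁻ z, ENNReal.ofReal (logDivergence (f z) (∫ w, f w ∂(Measure.pi fun _ => gaussianReal 0 1)))
        ∂(Measure.pi fun _ => gaussianReal 0 1) ≤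
      ∑ i, ∫⁻ z, ENNReal.ofReal (1 / 2 * (lineDeriv ℝ f z (Pi.single i 1) ^ 2 / f z))
        ∂(Measure.pi fun _ => gaussianReal 0 1) := by
  set P : Measure (Fin n → ℝ) := Measure.pi fun _ => gaussianReal 0 1
  set m := ∫ w, f w ∂P
  let ε : ℕ → ℝ := fun k => 1 / ((k : ℝ) + 1)
  have hε : ∀ k, 0 < ε k := fun k => Nat.one_div_pos_of_nat
  have hlim : Tendsto ε atTop (𝓝 0) := tendsto_one_div_add_atTop_nhds_zero_nat
  have hk : ∀ k, ∫⁻ z, ENNReal.ofReal (logDivergence (f z + ε k) (m + ε k)) ∂P ≤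
      ∑ i, ∫⁻ z, ENNReal.ofReal (1 / 2 * (lineDeriv ℝ f z (Pi.single i 1) ^ 2 / f z)) ∂P := by
    intro k
    have h1 := pi_gaussianReal_logSobolev (f := fun z => f z + ε k)
      (fun z => add_pos_of_nonneg_of_pos (hf z) (hε k)) (hdiff.add_const _)
      (hint.add (integrable_const _))
    rw [integral_add hint (integrable_const _), integral_const, probReal_univ, one_smul] at h1
    refine h1.trans (Finset.sum_le_sum fun i _ => lintegral_mono fun z =>
      ENNReal.ofReal_le_ofReal ?_)
    have h2 : lineDeriv ℝ (fun z => f z + ε k) z (Pi.single i 1) =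
        lineDeriv ℝ f z (Pi.single i 1) := by
      simp only [lineDeriv, deriv_add_const]
    rw [h2]
    rcases (hf z).eq_or_lt with hz | hz
    · rw [lineDeriv_eq_zero_of_nonneg hf hz.symm]
      simp
    · have := (hε k).le
      gcongr
      linarith
  have hlimz : ∀ z, Tendsto (fun k => ENNReal.ofReal (logDivergence (f z + ε k) (m + ε k))) atTop
      (𝓝 (ENNReal.ofReal (logDivergence (f z) m))) := fun z =>
    ENNReal.tendsto_ofReal (tendsto_logDivergence_add hm hε hlim)
  have hfatou := lintegral_liminf_le (μ := P) (u := atTop)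
    (f := fun k z => ENNReal.ofReal (logDivergence (f z + ε k) (m + ε k))) fun k =>
    (measurable_logDivergence (hdiff.continuous.measurable.add_const _)
      measurable_const).ennreal_ofReal
  rw [lintegral_congr fun z => (hlimz z).liminf_eq] at hfatou
  exact hfatou.trans (liminf_le_of_frequently_le' (Eventually.of_forall hk).frequently)

/-- The entropy integrand is the divergence plus `f - m`, which has mean zero. A finite `C` makes
everything integrable, so the extended integral is a Bochner integral. -/
theorem functionalEntropy_le_of_lintegral_logDivergence_le {E : Type*} [MeasurableSpace E]
    {μ : Measure E} [IsProbabilityMeasure μ] {f : E → ℝ} (hf : ∀ z, 0 ≤ f z) (hfm : Measurable f)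
    (hint : Integrable f μ) (hm : 0 < ∫ w, f w ∂μ) {C : ℝ≥0∞}
    (h : ∫⁻ z, ENNReal.ofReal (logDivergence (f z) (∫ w, f w ∂μ)) ∂μ ≤ C) :
    functionalEntropy μ f ≤ (C : EReal) := by
  rw [functionalEntropy]
  set m := ∫ w, f w ∂μ with hmdef
  rcases eq_or_ne C ∞ with rfl | hC
  · simp
  have h0 : ∀ z, 0 ≤ logDivergence (f z) m := fun z => logDivergence_nonneg' (hf z) hm
  have h1 : Integrable (fun z => logDivergence (f z) m) μ :=
    integrable_of_lintegral_ofReal_ne_top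
      (measurable_logDivergence hfm measurable_const).aestronglyMeasurable (ae_of_all _ h0)
      (ne_top_of_le_ne_top hC h)
  have h2 : (fun z => f z * Real.log (f z / m)) = fun z => logDivergence (f z) m + (f z - m) := by
    ext z
    rw [logDivergence]
    ring
  have h3 : Integrable (fun z => f z - m) μ := hint.sub (integrable_const _)
  rw [h2, extIntegral_eq_integral (h1.fun_add h3), integral_add h1 h3,
    integral_sub hint (integrable_const _), integral_const, probReal_univ, one_smul, ← hmdef,
    sub_self, add_zero]
  rw [← ofReal_integral_eq_lintegral_ofReal h1 (ae_of_all _ h0)] at h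
  have h4 := EReal.coe_ennreal_le_coe_ennreal_iff.2 h
  rwa [EReal.coe_ennreal_ofReal, max_eq_left (integral_nonneg h0)] at h4

/-- Division by zero and `Real.log 0` both return `0`, so the integrand vanishes identically. -/
theorem functionalEntropy_of_integral_eq_zero {E : Type*} [MeasurableSpace E] {μ : Measure E}
    {f : E → ℝ} (hm : ∫ w, f w ∂μ = 0) : functionalEntropy μ f = 0 := by
  simp [functionalEntropy, extIntegral, hm]

/-! ### Transfer to a general Gaussian by an affine map -/

section Multivariate

open scoped RealInnerProductSpace MatrixOrder

variable {d : ℕ}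

theorem measurePreserving_multivariateGaussian (x : EuclideanSpace ℝ (Fin d))
    (S : Matrix (Fin d) (Fin d) ℝ) :
    MeasurePreserving
      (fun y => x + Matrix.toEuclideanCLM (𝕜 := ℝ) (CFC.sqrt S) (WithLp.toLp 2 y))
      (Measure.pi fun _ => gaussianReal 0 1) (multivariateGaussian x S) := by
  refine ⟨by fun_prop, ?_⟩
  rw [multivariateGaussian, ← map_pi_eq_stdGaussian, Measure.map_map (by fun_prop) (by fun_prop)]
  rfl

/-- The chain rule gives `⟨∇f, √S eᵢ⟩`, and `√S` is self-adjoint. -/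
theorem lineDeriv_comp_sqrt {S : Matrix (Fin d) (Fin d) ℝ} {f : EuclideanSpace ℝ (Fin d) → ℝ}
    (hdiff : Differentiable ℝ f) (x : EuclideanSpace ℝ (Fin d)) (y : Fin d → ℝ) (i : Fin d) :
    lineDeriv ℝ (fun y => f (x + Matrix.toEuclideanCLM (𝕜 := ℝ) (CFC.sqrt S) (WithLp.toLp 2 y)))
        y (Pi.single i 1) =
      Matrix.toEuclideanCLM (𝕜 := ℝ) (CFC.sqrt S)
        (gradient f (x + Matrix.toEuclideanCLM (𝕜 := ℝ) (CFC.sqrt S) (WithLp.toLp 2 y))) i := by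
  set A := Matrix.toEuclideanCLM (𝕜 := ℝ) (CFC.sqrt S) with hA
  have hsa : IsSelfAdjoint A := (CFC.sqrt_nonneg S).isSelfAdjoint.map _
  set z := x + A (WithLp.toLp 2 y) with hz
  have h1 : ∀ t : ℝ, x + A (WithLp.toLp 2 (y + t • Pi.single i (1 : ℝ))) =
      z + t • A (EuclideanSpace.single i 1) := fun t => by
    rw [WithLp.toLp_add, WithLp.toLp_smul, map_add, map_smul, hz, add_assoc]
    rfl
  simp only [lineDeriv, h1]
  change lineDeriv ℝ f z (A (EuclideanSpace.single i 1)) = _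
  rw [(hdiff z).lineDeriv_eq_fderiv, ← inner_gradient_left,
    ← ContinuousLinearMap.adjoint_inner_left, hsa.adjoint_eq]
  simp [EuclideanSpace.inner_single_right]

theorem sum_sq_sqrt_apply {S : Matrix (Fin d) (Fin d) ℝ} (hS : S.PosSemidef)
    (v : EuclideanSpace ℝ (Fin d)) :
    ∑ i, (Matrix.toEuclideanCLM (𝕜 := ℝ) (CFC.sqrt S) v i) ^ 2 =
      inner ℝ (Matrix.toEuclideanCLM (𝕜 := ℝ) S v) v := by
  have hsa : IsSelfAdjoint (Matrix.toEuclideanCLM (𝕜 := ℝ) (CFC.sqrt S)) :=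
    (CFC.sqrt_nonneg S).isSelfAdjoint.map _
  rw [← EuclideanSpace.real_norm_sq_eq, ← real_inner_self_eq_norm_sq,
    ← ContinuousLinearMap.adjoint_inner_left, hsa.adjoint_eq, ← ContinuousLinearMap.comp_apply,
    ← ContinuousLinearMap.mul_def, ← map_mul, CFC.sqrt_mul_sqrt_self _ hS.nonneg]

/-- The logarithmic Sobolev inequality for a Gaussian measure on Euclidean space. -/
theorem functionalEntropy_multivariateGaussian_le (x : EuclideanSpace ℝ (Fin d)) (S : Matrix (Fin d) (Fin d) ℝ)
    (hS : S.PosSemidef) {f : EuclideanSpace ℝ (Fin d) → ℝ} (hf : ∀ z, 0 ≤ f z)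
    (hdiff : Differentiable ℝ f) (hint : Integrable f (multivariateGaussian x S)) :
    functionalEntropy (multivariateGaussian x S) f
      ≤ (((1 / 2 : ℝ≥0∞) * functionalFisherInfo x S f : ℝ≥0∞) : EReal) := by
  have hfm : Measurable f := hdiff.continuous.measurable
  have hm : 0 ≤ ∫ w, f w ∂(multivariateGaussian x S) := integral_nonneg hf
  rcases hm.eq_or_lt with hm | hm
  · rw [functionalEntropy_of_integral_eq_zero hm.symm]
    exact EReal.coe_ennreal_nonneg _
  refine functionalEntropy_le_of_lintegral_logDivergence_le hf hfm hint hm ?_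
  have mp := measurePreserving_multivariateGaussian x S
  have hdiffg : Differentiable ℝ fun y : Fin d → ℝ =>
      f (x + Matrix.toEuclideanCLM (𝕜 := ℝ) (CFC.sqrt S) (WithLp.toLp 2 y)) :=
    hdiff.comp (((Matrix.toEuclideanCLM (𝕜 := ℝ) (CFC.sqrt S)).differentiable.comp
      (PiLp.continuousLinearEquiv 2 ℝ fun _ : Fin d => ℝ).symm.differentiable).const_add x)
  have hmean : ∫ w, f w ∂(multivariateGaussian x S) =
      ∫ y, f (x + Matrix.toEuclideanCLM (𝕜 := ℝ) (CFC.sqrt S) (WithLp.toLp 2 y))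
        ∂(Measure.pi fun _ => gaussianReal 0 1) := by
    rw [← mp.map_eq, integral_map mp.aemeasurable hfm.aestronglyMeasurable]
  have hgrad : Measurable (gradient f) :=
    (InnerProductSpace.toDual ℝ (EuclideanSpace ℝ (Fin d))).symm.continuous.measurable.comp
      (measurable_fderiv ℝ f)
  have hFm : Measurable fun z => ENNReal.ofReal
      (inner ℝ (Matrix.toEuclideanCLM (𝕜 := ℝ) S (gradient f z)) (gradient f z) / f z) := by
    fun_prop
  rw [functionalFisherInfo, ← mp.lintegral_comp hFm,
    ← mp.lintegral_comp (measurable_logDivergence hfm measurable_const).ennreal_ofReal, hmean]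
  refine (pi_gaussianReal_logSobolev_of_nonneg (fun y => hf _) hdiffg
    (mp.integrable_comp_of_integrable hint) (hmean ▸ hm)).trans_eq ?_
  have hlm : ∀ i : Fin d, Measurable fun y : Fin d → ℝ => ENNReal.ofReal (1 / 2 *
      (lineDeriv ℝ (fun y : Fin d → ℝ =>
          f (x + Matrix.toEuclideanCLM (𝕜 := ℝ) (CFC.sqrt S) (WithLp.toLp 2 y))) y
          (Pi.single i 1) ^ 2 /
        f (x + Matrix.toEuclideanCLM (𝕜 := ℝ) (CFC.sqrt S) (WithLp.toLp 2 y)))) := fun i =>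
    ((((measurable_lineDeriv hdiffg.continuous).pow_const 2).div
      hdiffg.continuous.measurable).const_mul (1 / 2)).ennreal_ofReal
  -- The sum over coordinates moves inside, where the squared derivatives add up to `‖√S ∇f‖² = ⟨S
  -- ∇f, ∇f⟩`.
  rw [← lintegral_finsetSum _ fun i _ => hlm i,
    ← lintegral_const_mul' _ _ (by simp)]
  refine lintegral_congr fun y => ?_
  rw [← ENNReal.ofReal_sum_of_nonneg fun i _ =>
      mul_nonneg one_half_pos.le (div_nonneg (sq_nonneg _) (hf _)),
    ← Finset.mul_sum, ← Finset.sum_div]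
  simp_rw [lineDeriv_comp_sqrt hdiff]
  rw [sum_sq_sqrt_apply hS, ENNReal.ofReal_mul (by norm_num)]
  congr 1
  rw [ENNReal.ofReal_div_of_pos two_pos]
  simp

end Multivariate

end GaussianLogSobolev

theorem theorem1 {d : ℕ} (x : EuclideanSpace ℝ (Fin d)) (S : Matrix (Fin d) (Fin d) ℝ)
    (hS : S.PosSemidef) (f : EuclideanSpace ℝ (Fin d) → ℝ) (hf : ∀ z, 0 ≤ f z)
    (hdiff : Differentiable ℝ f) (hint : Integrable f (multivariateGaussian x S)) :
    functionalEntropy (multivariateGaussian x S) f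
      ≤ (((1 / 2 : ℝ≥0∞) * functionalFisherInfo x S f : ℝ≥0∞) : EReal) :=
  functionalEntropy_multivariateGaussian_le x S hS hf hdiff hint
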